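/- A loopless mixed graph (LMG) has a finite node set and undirected ($i-j$), directed ($i\to j$) and bidirected ($i\leftrightarrow j$) edges between distinct nodes; edges of different types between the same two nodes are allowed. Paths have pairwise distinct nodes. A non-endpoint of a path is a collider on it if both path edges at it have an arrowhead there; a collider path is a path all of whose non-endpoints are colliders. We call $i$ an ancestor of $j$, and $j$ a descendant of $i$, if there is a directed path from $i$ to $j$ with at least one edge. A path is $m$-connecting given $C$ if each of its colliders lies in $C$ or is an ancestor of a node of $C$, and none of its other nodes (endpoints included) lies in $C$. The independence model $\mathcal J(\mathcal G)$ is the set of triples $\langle A,B\mid C\rangle$ of pairwise disjoint node sets such that no path between a node of $A$ and a node of $B$ is $m$-connecting given $C$; two graphs are Markov equivalent if they have the same independence model. An LMG is maximal if adding any edge between two nonadjacent nodes changes its independence model. An LMG is ancestral if it has no directed cycle, if $i\leftrightarrow j$ implies that neither of $i,j$ is an ancestor of the other, and if $i-j$ implies that no edge has an arrowhead at $i$ or $j$. It is ribbonless if it contains no collider path $\langle i,j,k\rangle$ such that there is no edge between $i$ and $k$ with the same arrowheads at $i$ and at $k$ as the path, and $j$ or a descendant of $j$ is an endpoint of an undirected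 edge or on a directed cycle. An inducing path between $i$ and $j$ is a path each of whose non-endpoints is a collider on it and an ancestor of $i$ or of $j$. A maximal extension of an LMG $\mathcal G$ is a maximal ribbonless graph that contains $\mathcal G$, is Markov equivalent to $\mathcal G$, and arises from $\mathcal G$ by adding edges, each joining the nonadjacent endpoints of some inducing path in $\mathcal G$ and having the same arrowheads at its endpoints as that path. Let $\mathcal I$ be a finite multiset of subsets of the node set $[p]$ of an LMG $\mathcal G$. The interventional graph $\mathcal G^{\mathcal I}$ is obtained from $\mathcal G$ by adding a node $\omega_I$ for each nonempty element $I$ of the multiset $\mathcal I$, and the edges $\omega_I\to i$ for $i\in I$. **Proposition.** Let $\mathcal G=([p],E)$ be an ancestral graph, and let $\mathcal I$ be such that no endpoint of an undirected edge of $\mathcal G$ belongs to two distinct elements of the multiset $\mathcal I$. Then $\mathcal G$ has exactly one maximal extension $\overline{\mathcal G}$, which is also the only maximal ancestral graph that contains $\mathcal G$ and is Markov equivalent to $\mathcal G$; the graph $\mathcal G^{\mathcal I}$ has exactly one maximal extension $\overline{\mathcal G^{\mathcal I}}$; and $$\overline{\mathcal G}^{\,\mathcal I}=\overline{\mathcal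 G^{\mathcal I}}.$$ -/

import Mathlib

/-- A loopless mixed graph on the node set `V`: undirected edges `i - j`, directed edges `i → j`
and bidirected edges `i ↔ j`. Edges of different types between the same two nodes are allowed. -/
@[ext]
structure LMG (V : Type*) where
  und : V → V → Prop
  dir : V → V → Prop
  bid : V → V → Prop
  und_symm : ∀ i j, und i j → und j i
  bid_symm : ∀ i j, bid i j → bid j i
  und_loopless : ∀ i, ¬ und i i
  dir_loopless : ∀ i, ¬ dir i i
  bid_loopless : ∀ i, ¬ bid i i

/-- The four ways in which an edge can be traversed from `i` to `j`:
`i - j`, `i → j`, `i ← j`, `i ↔ j`. -/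
inductive EdgeType
  | und
  | fwd
  | bwd
  | bid

namespace EdgeType

/-- The edge has an arrowhead at the node where the traversal starts. -/
def HeadAtStart : EdgeType → Prop
  | und => False
  | fwd => False
  | bwd => True
  | bid => True

/-- The edge has an arrowhead at the node where the traversal ends. -/
def HeadAtEnd : EdgeType → Prop
  | und => False
  | fwd => True
  | bwd => False
  | bid => True

end EdgeType

namespace LMG

variable {V : Type*}

/-- `G` contains the edge of type `e` between `i` and `j`, read from `i` to `j`. -/
def HasEdge (G : LMG V) : EdgeType → V → V → Prop
  | .und, i, j => G.und i j
  | .fwd, i, j => G.dir i j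
  | .bwd, i, j => G.dir j i
  | .bid, i, j => G.bid i j

/-- Two nodes are adjacent if they are the endpoints of some edge. -/
def Adj (G : LMG V) (i j : V) : Prop := ∃ e, G.HasEdge e i j

/-- Every edge of `G` is an edge of `H`. -/
def IsContainedIn (G H : LMG V) : Prop := ∀ e i j, G.HasEdge e i j → H.HasEdge e i j

/-- The graph obtained from `G` by adding the edge of type `e` between `a` and `b`. -/
def addEdge (G : LMG V) (e : EdgeType) (a b : V) (hab : a ≠ b) : LMG V where
  und i j := G.und i j ∨ (e = .und ∧ ((i = a ∧ j = b) ∨ (i = b ∧ j = a)))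
  dir i j := G.dir i j ∨ (e = .fwd ∧ i = a ∧ j = b) ∨ (e = .bwd ∧ i = b ∧ j = a)
  bid i j := G.bid i j ∨ (e = .bid ∧ ((i = a ∧ j = b) ∨ (i = b ∧ j = a)))
  und_symm := by
    rintro i j (h | ⟨h, h'⟩)
    · exact Or.inl (G.und_symm _ _ h)
    · exact Or.inr ⟨h, by tauto⟩
  bid_symm := by
    rintro i j (h | ⟨h, h'⟩)
    · exact Or.inl (G.bid_symm _ _ h)
    · exact Or.inr ⟨h, by tauto⟩
  und_loopless := by
    rintro i (h | ⟨-, ⟨rfl, h⟩ | ⟨rfl, h⟩⟩)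
    · exact G.und_loopless _ h
    · exact hab h
    · exact hab h.symm
  dir_loopless := by
    rintro i (h | ⟨-, rfl, h⟩ | ⟨-, rfl, h⟩)
    · exact G.dir_loopless _ h
    · exact hab h
    · exact hab h.symm
  bid_loopless := by
    rintro i (h | ⟨-, ⟨rfl, h⟩ | ⟨rfl, h⟩⟩)
    · exact G.bid_loopless _ h
    · exact hab h
    · exact hab h.symm

/-- `i` is an ancestor of `j`: there is a directed path from `i` to `j` with at least one edge.
(`G.Ancestor i i` means that `i` lies on a directed cycle.) -/
def Ancestor (G : LMG V) : V → V → Prop := Relation.TransGen G.dir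

/-- A path between `a` and `b`: pairwise distinct nodes `vert 0 = a, …, vert len = b`, and for
each `k < len` an edge of `G` between `vert k` and `vert (k + 1)`. The values of `vert` beyond
`len` and of `edge` from `len` on are irrelevant. -/
structure Path (G : LMG V) (a b : V) where
  len : ℕ
  vert : ℕ → V
  edge : ℕ → EdgeType
  vert_zero : vert 0 = a
  vert_len : vert len = b
  hasEdge : ∀ k < len, G.HasEdge (edge k) (vert k) (vert (k + 1))
  nodup : ∀ k ≤ len, ∀ l ≤ len, vert k = vert l → k = l

namespace Path

variable {G : LMG V} {a b : V}

/-- The `k`-th node of the path is not an endpoint of it, and both edges of the path at this node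
have an arrowhead there. -/
def IsCollider (π : G.Path a b) (k : ℕ) : Prop :=
  0 < k ∧ k < π.len ∧ (π.edge (k - 1)).HeadAtEnd ∧ (π.edge k).HeadAtStart

/-- The path is `m`-connecting given `C`: every collider is in `C` or an ancestor of a node in `C`,
and no other node (endpoints included) is in `C`. -/
def MConnecting (π : G.Path a b) (C : Set V) : Prop :=
  ∀ k ≤ π.len,
    (π.IsCollider k → π.vert k ∈ C ∨ ∃ c ∈ C, G.Ancestor (π.vert k) c) ∧
    (¬ π.IsCollider k → π.vert k ∉ C)

/-- An inducing path: every non-endpoint is a collider and an ancestor of an endpoint. -/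
def IsInducing (π : G.Path a b) : Prop :=
  ∀ k, 0 < k → k < π.len →
    π.IsCollider k ∧ (G.Ancestor (π.vert k) a ∨ G.Ancestor (π.vert k) b)

/-- An edge of type `e` from `a` to `b` is endpoint-identical to the path: it has an arrowhead at
`a` iff the first edge of the path has, and an arrowhead at `b` iff the last edge has. -/
def EndpointIdentical (π : G.Path a b) (e : EdgeType) : Prop :=
  0 < π.len ∧ (e.HeadAtStart ↔ (π.edge 0).HeadAtStart) ∧
    (e.HeadAtEnd ↔ (π.edge (π.len - 1)).HeadAtEnd)

end Path

/-- `C` `m`-separates `A` and `B`. -/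
def MSeparates (G : LMG V) (A B C : Set V) : Prop :=
  ∀ a ∈ A, ∀ b ∈ B, ∀ π : G.Path a b, ¬ π.MConnecting C

/-- The formal independence model of `G`: the triples `⟨A, B | C⟩` of pairwise disjoint sets of
nodes such that `C` `m`-separates `A` and `B`. -/
def independenceModel (G : LMG V) : Set (Set V × Set V × Set V) :=
  {t | Disjoint t.1 t.2.1 ∧ Disjoint t.1 t.2.2 ∧ Disjoint t.2.1 t.2.2 ∧
    G.MSeparates t.1 t.2.1 t.2.2}

/-- Markov equivalence. -/
def MarkovEquiv (G H : LMG V) : Prop := G.independenceModel = H.independenceModel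

/-- `G` is maximal: adding any edge between two nonadjacent nodes changes the independence
model. -/
def IsMaximal (G : LMG V) : Prop :=
  ∀ (e : EdgeType) (a b : V) (hab : a ≠ b), ¬ G.Adj a b →
    ¬ (G.addEdge e a b hab).MarkovEquiv G

/-- Ancestral graphs. -/
structure IsAncestral (G : LMG V) : Prop where
  no_directed_cycle : ∀ i, ¬ G.Ancestor i i
  bid_not_ancestor : ∀ i j, G.bid i j → ¬ G.Ancestor i j ∧ ¬ G.Ancestor j i
  und_no_arrowhead : ∀ i j, G.und i j → ∀ k,
    ¬ G.dir k i ∧ ¬ G.bid k i ∧ ¬ G.dir k j ∧ ¬ G.bid k j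

/-- The node `i` is an endpoint of an undirected edge. -/
def SelectionAdjacent (G : LMG V) (i : V) : Prop := ∃ j, G.und i j

/-- The triple `⟨i, j, k⟩`, with the edges read from `i` to `j` as `e` and from `j` to `k` as `f`,
is a ribbon: a collider path without an endpoint-identical edge between `i` and `k` such that `j`
or a descendant of `j` is an endpoint of an undirected edge or on a directed cycle. -/
def IsRibbon (G : LMG V) (i j k : V) (e f : EdgeType) : Prop :=
  i ≠ k ∧ G.HasEdge e i j ∧ G.HasEdge f j k ∧ e.HeadAtEnd ∧ f.HeadAtStart ∧
  (¬ ∃ g : EdgeType, G.HasEdge g i k ∧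
    (g.HeadAtStart ↔ e.HeadAtStart) ∧ (g.HeadAtEnd ↔ f.HeadAtEnd)) ∧
  ∃ d, (d = j ∨ G.Ancestor j d) ∧ (G.SelectionAdjacent d ∨ G.Ancestor d d)

/-- Ribbonless graphs. -/
def IsRibbonless (G : LMG V) : Prop := ∀ i j k e f, ¬ G.IsRibbon i j k e f

/-- `H` is a maximal ancestral graph that contains `G` and is Markov equivalent to `G`. -/
structure IsMaximalAncestralExtension (G H : LMG V) : Prop where
  contains : G.IsContainedIn H
  ancestral : H.IsAncestral
  maximal : H.IsMaximal
  markovEquiv : H.MarkovEquiv G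

/-- `H` is a maximal ribbonless graph that contains `G`, is Markov equivalent to `G`, and arises
from `G` by adding, between nonadjacent endpoints of inducing paths in `G`, edges that are
endpoint-identical to these paths. -/
structure IsMaximalRibbonlessExtension (G H : LMG V) : Prop where
  contains : G.IsContainedIn H
  ribbonless : H.IsRibbonless
  maximal : H.IsMaximal
  markovEquiv : H.MarkovEquiv G
  added : ∀ e a b, H.HasEdge e a b → ¬ G.HasEdge e a b →
    ¬ G.Adj a b ∧ ∃ π : G.Path a b, π.IsInducing ∧ π.EndpointIdentical e

variable {ι : Type*}

/-- The interventional graph `G^I`. The multiset `I` of intervention targets is an indexed family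
`I : ι → Set V`, so that equal targets with different indices count as distinct elements. The new
nodes are the `ω_t` for the indices `t` with `I t ≠ ∅`, and the new edges are `ω_t → i` for
`i ∈ I t`. -/
def interventional (G : LMG V) (I : ι → Set V) : LMG (V ⊕ {t : ι // (I t).Nonempty}) where
  und x y := ∃ i j, x = Sum.inl i ∧ y = Sum.inl j ∧ G.und i j
  dir x y := (∃ i j, x = Sum.inl i ∧ y = Sum.inl j ∧ G.dir i j) ∨
    ∃ t i, x = Sum.inr t ∧ y = Sum.inl i ∧ i ∈ I t.1
  bid x y := ∃ i j, x = Sum.inl i ∧ y = Sum.inl j ∧ G.bid i j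
  und_symm := by
    rintro _ _ ⟨i, j, rfl, rfl, h⟩
    exact ⟨j, i, rfl, rfl, G.und_symm _ _ h⟩
  bid_symm := by
    rintro _ _ ⟨i, j, rfl, rfl, h⟩
    exact ⟨j, i, rfl, rfl, G.bid_symm _ _ h⟩
  und_loopless := by
    rintro _ ⟨i, j, rfl, h, h'⟩
    cases h
    exact G.und_loopless _ h'
  dir_loopless := by
    rintro _ (⟨i, j, rfl, h, h'⟩ | ⟨t, i, rfl, h, -⟩)
    · cases h
      exact G.dir_loopless _ h'
    · cases h
  bid_loopless := by
    rintro _ ⟨i, j, rfl, h, h'⟩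
    cases h
    exact G.bid_loopless _ h'

/-- The targets `I` doubly-intervene on `i`: two distinct members of the family contain `i`. -/
def DoublyIntervenes (I : ι → Set V) (i : V) : Prop := ∃ s t, s ≠ t ∧ i ∈ I s ∧ i ∈ I t

end LMG

namespace EdgeType

/-- The same edge, traversed in the opposite direction. -/
def flip : EdgeType → EdgeType
  | und => und
  | fwd => bwd
  | bwd => fwd
  | bid => bid

theorem headAtStart_flip (e : EdgeType) : e.flip.HeadAtStart ↔ e.HeadAtEnd := by
  cases e <;> exact Iff.rfl

theorem headAtEnd_flip (e : EdgeType) : e.flip.HeadAtEnd ↔ e.HeadAtStart := by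
  cases e <;> exact Iff.rfl

end EdgeType

namespace LMG

variable {V : Type*}

theorem HasEdge.flip {G : LMG V} {e : EdgeType} {i j : V} (h : G.HasEdge e i j) :
    G.HasEdge e.flip j i := by
  cases e
  · exact G.und_symm _ _ h
  · exact h
  · exact h
  · exact G.bid_symm _ _ h

theorem HasEdge.ne {G : LMG V} {e : EdgeType} {i j : V} (h : G.HasEdge e i j) : i ≠ j := by
  rintro rfl
  cases e
  · exact G.und_loopless _ h
  · exact G.dir_loopless _ h
  · exact G.dir_loopless _ h
  · exact G.bid_loopless _ h

theorem Adj.symm {G : LMG V} {i j : V} (h : G.Adj i j) : G.Adj j i :=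
  let ⟨_, he⟩ := h
  ⟨_, he.flip⟩

/-- Some edge between `i` and `j` has an arrowhead at `j`. -/
def Into (G : LMG V) (i j : V) : Prop := G.dir i j ∨ G.bid i j

theorem HasEdge.into_of_headAtEnd {G : LMG V} {e : EdgeType} {i j : V} (h : G.HasEdge e i j)
    (he : e.HeadAtEnd) : G.Into i j := by
  cases e
  · exact he.elim
  · exact Or.inl h
  · exact he.elim
  · exact Or.inr h

theorem HasEdge.into_of_headAtStart {G : LMG V} {e : EdgeType} {i j : V} (h : G.HasEdge e i j)
    (he : e.HeadAtStart) : G.Into j i :=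
  h.flip.into_of_headAtEnd (e.headAtEnd_flip.2 he)

theorem Ancestor.mono {G H : LMG V} (h : ∀ i j, G.dir i j → H.dir i j) {i j : V}
    (hij : G.Ancestor i j) : H.Ancestor i j :=
  Relation.TransGen.mono (fun _ _ h' => h _ _ h') _ _ hij

theorem ancestor_congr {G H : LMG V} (h : G.dir = H.dir) : G.Ancestor = H.Ancestor := by
  unfold Ancestor
  rw [h]

/-- Graphs without directed cycles in which the endpoints of a bidirected edge are not ancestors
of each other, and in which a node that two different neighbours point to neither is nor has a
descendant that is an endpoint of an undirected edge. -/
structure IsColliderRegular (G : LMG V) : Prop where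
  no_directed_cycle : ∀ i, ¬ G.Ancestor i i
  bid_not_ancestor : ∀ i j, G.bid i j → ¬ G.Ancestor i j ∧ ¬ G.Ancestor j i
  collider_not_selection : ∀ i j k, i ≠ k → G.Into i j → G.Into k j →
    ∀ d, d = j ∨ G.Ancestor j d → ¬ G.SelectionAdjacent d

theorem IsColliderRegular.isRibbonless {G : LMG V} (hG : G.IsColliderRegular) :
    G.IsRibbonless := by
  rintro i j k e f ⟨hik, he, hf, hej, hfj, -, d, hd, hS | hc⟩
  · exact hG.collider_not_selection i j k hik (he.into_of_headAtEnd hej)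
      (hf.into_of_headAtStart hfj) d hd hS
  · exact hG.no_directed_cycle d hc

theorem IsAncestral.not_into_of_und {G : LMG V} (hG : G.IsAncestral) {i j : V}
    (h : G.und i j) (k : V) : ¬ G.Into k i := by
  rintro (h' | h')
  · exact (hG.und_no_arrowhead i j h k).1 h'
  · exact (hG.und_no_arrowhead i j h k).2.1 h'

theorem IsAncestral.isColliderRegular {G : LMG V} (hG : G.IsAncestral) :
    G.IsColliderRegular where
  no_directed_cycle := hG.no_directed_cycle
  bid_not_ancestor := hG.bid_not_ancestor
  collider_not_selection := by
    rintro i j k - hi - d (rfl | hd) ⟨l, hl⟩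
    · exact hG.not_into_of_und hl i hi
    · obtain ⟨m, -, hm⟩ := Relation.TransGen.tail'_iff.1 hd
      exact hG.not_into_of_und hl m (Or.inl hm)

namespace Path

variable {G : LMG V} {a b : V}

/-- The path, traversed in the opposite direction. -/
def reverse (π : G.Path a b) : G.Path b a where
  len := π.len
  vert k := π.vert (π.len - k)
  edge k := (π.edge (π.len - 1 - k)).flip
  vert_zero := by simpa using π.vert_len
  vert_len := by simpa using π.vert_zero
  hasEdge := by
    intro k hk
    have h := (π.hasEdge (π.len - 1 - k) (by omega)).flip
    rwa [show π.len - 1 - k + 1 = π.len - k by omega,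
      show π.vert (π.len - 1 - k) = π.vert (π.len - (k + 1)) by congr 1; omega] at h
  nodup := by
    intro k hk l hl h
    have := π.nodup _ (by omega) _ (by omega) h
    omega

theorem IsCollider.reverse {π : G.Path a b} {k : ℕ} (h : π.IsCollider k) :
    π.reverse.IsCollider (π.len - k) := by
  obtain ⟨h0, hn, h1, h2⟩ := h
  refine ⟨?_, ?_, ?_, ?_⟩
  · omega
  · change π.len - k < π.len
    omega
  · change (π.edge (π.len - 1 - (π.len - k - 1))).flip.HeadAtEnd
    rw [EdgeType.headAtEnd_flip, show π.len - 1 - (π.len - k - 1) = k by omega]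
    exact h2
  · change (π.edge (π.len - 1 - (π.len - k))).flip.HeadAtStart
    rw [EdgeType.headAtStart_flip, show π.len - 1 - (π.len - k) = k - 1 by omega]
    exact h1

theorem IsInducing.reverse {π : G.Path a b} (h : π.IsInducing) : π.reverse.IsInducing := by
  intro k h0 hn
  change k < π.len at hn
  obtain ⟨h1, h2⟩ := h (π.len - k) (by omega) (by omega)
  refine ⟨?_, h2.symm⟩
  have := h1.reverse
  rwa [show π.len - (π.len - k) = k by omega] at this

theorem two_le_len (π : G.Path a b) (hab : a ≠ b) (h : ¬ G.Adj a b) : 2 ≤ π.len := by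
  by_contra hlt
  have h01 : π.len = 0 ∨ π.len = 1 := by omega
  rcases h01 with h0 | h1
  · exact hab (π.vert_zero.symm.trans (h0 ▸ π.vert_len))
  · apply h
    have h2 := π.hasEdge 0 (by omega)
    have h3 := π.vert_len
    rw [h1] at h3
    rw [π.vert_zero, zero_add, h3] at h2
    exact ⟨_, h2⟩

/-- A path in `G` is a path in every graph that contains `G`. -/
def ofContained {H : LMG V} (h : G.IsContainedIn H) (π : G.Path a b) : H.Path a b where
  len := π.len
  vert := π.vert
  edge := π.edge
  vert_zero := π.vert_zero
  vert_len := π.vert_len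
  hasEdge k hk := h _ _ _ (π.hasEdge k hk)
  nodup := π.nodup

/-- The path that consists of a single edge. -/
def ofEdge {e : EdgeType} (h : G.HasEdge e a b) : G.Path a b where
  len := 1
  vert k := if k = 0 then a else b
  edge _ := e
  vert_zero := rfl
  vert_len := rfl
  hasEdge k hk := by
    obtain rfl : k = 0 := by omega
    exact h
  nodup k hk l hl hkl := by
    have := h.ne
    split_ifs at hkl <;> first | omega | exact absurd hkl ‹_› | exact absurd hkl.symm ‹_›

theorem ofEdge_mConnecting {e : EdgeType} (h : G.HasEdge e a b) {C : Set V} (ha : a ∉ C)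
    (hb : b ∉ C) : (ofEdge h).MConnecting C := by
  intro k hk
  refine ⟨fun hc => ?_, fun _ => ?_⟩
  · have h1 : k < 1 := hc.2.1
    have h0 := hc.1
    omega
  · change (if k = 0 then a else b) ∉ C
    split_ifs <;> assumption

theorem IsInducing.not_ancestor {π : G.Path a b} (h : π.IsInducing)
    (hcyc : ∀ i, ¬ G.Ancestor i i)
    (hbid : ∀ i j, G.bid i j → ¬ G.Ancestor i j ∧ ¬ G.Ancestor j i)
    (hlen : 2 ≤ π.len) : ¬ G.Ancestor a b := by
  intro hab
  obtain ⟨⟨-, -, -, hs⟩, han⟩ := h (π.len - 1) (by omega) (by omega)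
  have hanb : G.Ancestor (π.vert (π.len - 1)) b :=
    han.elim (fun h' => Relation.TransGen.trans h' hab) id
  have hedge := π.hasEdge (π.len - 1) (by omega)
  rw [show π.len - 1 + 1 = π.len by omega, π.vert_len] at hedge
  generalize π.edge (π.len - 1) = e at hs hedge
  cases e
  · exact hs
  · exact hs
  · exact hcyc _ (Relation.TransGen.trans hanb (Relation.TransGen.single hedge))
  · exact (hbid _ _ hedge).1 hanb

theorem IsInducing.edge_zero {π : G.Path a b} (h : π.IsInducing)
    (hcyc : ∀ i, ¬ G.Ancestor i i)
    (hbid : ∀ i j, G.bid i j → ¬ G.Ancestor i j ∧ ¬ G.Ancestor j i)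
    (hlen : 2 ≤ π.len) : π.edge 0 = .bid := by
  have hnab := h.not_ancestor hcyc hbid hlen
  obtain ⟨⟨-, -, he, -⟩, han⟩ := h 1 (by omega) (by omega)
  have hedge := π.hasEdge 0 (by omega)
  rw [π.vert_zero, zero_add] at hedge
  rw [Nat.sub_self] at he
  generalize π.edge 0 = e at he hedge
  cases e
  · exact he.elim
  · have h1 : G.Ancestor a (π.vert 1) := Relation.TransGen.single hedge
    rcases han with h2 | h2
    · exact (hcyc _ (Relation.TransGen.trans h1 h2)).elim
    · exact (hnab (Relation.TransGen.trans h1 h2)).elim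
  · exact he.elim
  · rfl

/-- All edges of an inducing path with at least two edges are bidirected. -/
theorem IsInducing.edge_eq_bid {π : G.Path a b} (h : π.IsInducing)
    (hcyc : ∀ i, ¬ G.Ancestor i i)
    (hbid : ∀ i j, G.bid i j → ¬ G.Ancestor i j ∧ ¬ G.Ancestor j i)
    (hlen : 2 ≤ π.len) {k : ℕ} (hk : k < π.len) : π.edge k = .bid := by
  rcases Nat.eq_zero_or_pos k with rfl | h0
  · exact h.edge_zero hcyc hbid hlen
  by_cases hk1 : k + 1 < π.len
  · have h1 := (h k h0 hk).1.2.2.2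
    have h2 := (h (k + 1) (by omega) hk1).1.2.2.1
    rw [Nat.add_sub_cancel] at h2
    generalize π.edge k = e at h1 h2
    cases e
    · exact h1.elim
    · exact h1.elim
    · exact h2.elim
    · rfl
  · have h1 := h.reverse.edge_zero hcyc hbid hlen
    change (π.edge (π.len - 1 - 0)).flip = .bid at h1
    rw [show π.len - 1 - 0 = k by omega] at h1
    generalize π.edge k = e at h1
    cases e <;> first | rfl | cases h1

end Path

/-- The graph obtained from `G` by adding bidirected edges between the nonadjacent endpoints of
inducing paths. -/
def bidClosure (G : LMG V) : LMG V where
  und := G.und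
  dir := G.dir
  bid a b := G.bid a b ∨ (a ≠ b ∧ ¬ G.Adj a b ∧ ∃ π : G.Path a b, π.IsInducing)
  und_symm := G.und_symm
  bid_symm := by
    rintro i j (h | ⟨h, h', π, hπ⟩)
    · exact Or.inl (G.bid_symm _ _ h)
    · exact Or.inr ⟨h.symm, fun h'' => h' h''.symm, π.reverse, hπ.reverse⟩
  und_loopless := G.und_loopless
  dir_loopless := G.dir_loopless
  bid_loopless := by
    rintro i (h | h)
    · exact G.bid_loopless _ h
    · exact h.1 rfl

theorem isContainedIn_bidClosure (G : LMG V) : G.IsContainedIn G.bidClosure := by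
  rintro (_ | _ | _ | _) i j h
  · exact h
  · exact h
  · exact h
  · exact Or.inl h

theorem ancestor_bidClosure (G : LMG V) : G.bidClosure.Ancestor = G.Ancestor := rfl

theorem IsAncestral.bidClosure {G : LMG V} (hG : G.IsAncestral) : G.bidClosure.IsAncestral where
  no_directed_cycle := hG.no_directed_cycle
  bid_not_ancestor := by
    rintro i j (h | ⟨h, h', π, hπ⟩)
    · exact hG.bid_not_ancestor i j h
    · have hlen := π.two_le_len h h'
      exact ⟨hπ.not_ancestor hG.no_directed_cycle hG.bid_not_ancestor hlen,
        hπ.reverse.not_ancestor hG.no_directed_cycle hG.bid_not_ancestor hlen⟩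
  und_no_arrowhead := by
    have key : ∀ i j, G.und i j → ∀ k, ¬ G.bidClosure.bid k i := by
      rintro i j h k (hk | ⟨hki, hk', π, hπ⟩)
      · exact (hG.und_no_arrowhead i j h k).2.1 hk
      · have hlen := π.two_le_len hki hk'
        have h1 := π.hasEdge (π.len - 1) (by omega)
        rw [hπ.edge_eq_bid hG.no_directed_cycle hG.bid_not_ancestor hlen (by omega),
          show π.len - 1 + 1 = π.len by omega, π.vert_len] at h1
        exact (hG.und_no_arrowhead i j h _).2.1 h1
    intro i j h k
    have h' := hG.und_no_arrowhead i j h k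
    exact ⟨h'.1, key i j h k, h'.2.2.1, key j i (G.und_symm _ _ h) k⟩

/-! ### Connecting walks -/

/-- The node `v` does not block a walk given `C`, where `col` says whether it is a collider. -/
def Open (G : LMG V) (C : Set V) (v : V) (col : Prop) : Prop :=
  (col → v ∈ C ∨ ∃ c ∈ C, G.Ancestor v c) ∧ (¬ col → v ∉ C)

/-- `G.ConnWalk C a p b q`: there is a walk from `a` to `b` with at least one edge, none of whose
inner nodes blocks it given `C`; `p` and `q` say whether its first edge has an arrowhead at `a`
and its last edge one at `b`. -/
inductive ConnWalk (G : LMG V) (C : Set V) : V → Prop → V → Prop → Prop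
  | single {e : EdgeType} {a b : V} (h : G.HasEdge e a b) :
      ConnWalk G C a e.HeadAtStart b e.HeadAtEnd
  | snoc {a b c : V} {p q : Prop} {e : EdgeType} (hw : ConnWalk G C a p b q)
      (h : G.HasEdge e b c) (ho : G.Open C b (q ∧ e.HeadAtStart)) :
      ConnWalk G C a p c e.HeadAtEnd

namespace ConnWalk

variable {G : LMG V} {C : Set V}

theorem trans {a b c : V} {p q r s : Prop} (h : G.ConnWalk C a p b q)
    (h' : G.ConnWalk C b r c s) (ho : G.Open C b (q ∧ r)) : G.ConnWalk C a p c s := by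
  induction h' with
  | single he => exact h.snoc he ho
  | snoc hw he hopen ih => exact (ih h ho).snoc he hopen

/-- The nodes on a directed path from `v` do not block it if neither `v` nor a descendant of `v`
is in `C`. -/
theorem of_ancestor {v w : V} (h : G.Ancestor v w) (hv : ∀ c ∈ C, ¬ G.Ancestor v c) :
    G.ConnWalk C v False w True := by
  induction h with
  | single h => exact single (e := .fwd) h
  | tail h h' ih => exact ih.snoc (e := .fwd) h' ⟨fun hc => hc.2.elim, fun _ hC => hv _ hC h⟩

theorem of_ancestor_reverse {v w : V} (h : G.Ancestor v w) (hv : ∀ c ∈ C, ¬ G.Ancestor v c) :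
    G.ConnWalk C w True v False := by
  induction h with
  | single h => exact single (e := .bwd) h
  | tail h h' ih =>
    exact (single (e := .bwd) h').trans ih ⟨fun hc => hc.1.elim, fun _ hC => hv _ hC h⟩

/-- The endpoints of a bidirected inducing path are connected given any `C`, by a walk with
arrowheads at both of them. -/
theorem of_bidirected_inducing {a b : V} (π : G.Path a b) (hπ : π.IsInducing)
    (hlen : 0 < π.len) (hbid : ∀ k < π.len, π.edge k = .bid) : G.ConnWalk C a True b True := by
  have edge : ∀ k < π.len, G.HasEdge .bid (π.vert k) (π.vert (k + 1)) := fun k hk =>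
    hbid k hk ▸ π.hasEdge k hk
  have key : ∀ k < π.len,
      G.ConnWalk C a True (π.vert (k + 1)) True ∨ G.ConnWalk C a True b True := by
    intro k
    induction k with
    | zero =>
      intro h0
      have h := edge 0 h0
      rw [π.vert_zero] at h
      exact Or.inl (single (e := .bid) h)
    | succ k ih =>
      intro hk
      rcases ih (by omega) with h | h
      · have he := edge (k + 1) hk
        by_cases hgood : π.vert (k + 1) ∈ C ∨ ∃ c ∈ C, G.Ancestor (π.vert (k + 1)) c
        · exact Or.inl (h.snoc (e := .bid) he
            ⟨fun _ => hgood, fun hn => (hn ⟨trivial, trivial⟩).elim⟩)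
        · push Not at hgood
          rcases (hπ (k + 1) (by omega) hk).2 with ha | hb
          · exact Or.inl ((of_ancestor_reverse ha hgood.2).snoc (e := .bid) he
              ⟨fun hc => hc.1.elim, fun _ => hgood.1⟩)
          · exact Or.inr (h.trans (of_ancestor hb hgood.2)
              ⟨fun hc => hc.2.elim, fun _ => hgood.1⟩)
      · exact Or.inr h
  rcases key (π.len - 1) (by omega) with h | h
  · rwa [show π.len - 1 + 1 = π.len by omega, π.vert_len] at h
  · exact h

/-- A connecting walk in a graph gives one in `G` if every edge can be replaced by a connecting
walk in `G` with the same arrowheads. -/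
theorem of_edges {H : LMG V} (hanc : H.Ancestor = G.Ancestor)
    (hedge : ∀ e i j, H.HasEdge e i j → G.ConnWalk C i e.HeadAtStart j e.HeadAtEnd)
    {a b : V} {p q : Prop} (h : H.ConnWalk C a p b q) : G.ConnWalk C a p b q := by
  induction h with
  | single h => exact hedge _ _ _ h
  | snoc hw h ho ih =>
    refine ih.trans (hedge _ _ _ h) ?_
    unfold Open at ho ⊢
    rwa [hanc] at ho

theorem of_path {a b : V} (π : G.Path a b) (hπ : π.MConnecting C) (hlen : 0 < π.len) :
    ∃ p q, G.ConnWalk C a p b q := by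
  have key : ∀ k < π.len, ∃ p, G.ConnWalk C a p (π.vert (k + 1)) (π.edge k).HeadAtEnd := by
    intro k
    induction k with
    | zero =>
      intro h0
      have h := π.hasEdge 0 h0
      rw [π.vert_zero] at h
      exact ⟨_, single h⟩
    | succ k ih =>
      intro hk
      obtain ⟨p, hp⟩ := ih (by omega)
      refine ⟨p, hp.snoc (π.hasEdge (k + 1) hk) ?_⟩
      have h := hπ (k + 1) (by omega)
      refine ⟨fun hc => h.1 ⟨by omega, hk, hc.1, hc.2⟩, fun hc => h.2 fun hc' => hc ?_⟩
      exact ⟨hc'.2.2.1, hc'.2.2.2⟩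
  obtain ⟨p, hp⟩ := key (π.len - 1) (by omega)
  rw [show π.len - 1 + 1 = π.len by omega, π.vert_len] at hp
  exact ⟨_, _, hp⟩

end ConnWalk

/-- The sequences `vert` and `edge` form a walk of length `n` from `a` to `b` that is connecting
given `C`; its nodes need not be distinct. -/
structure IsConnSeq (G : LMG V) (C : Set V) (a b : V) (n : ℕ) (vert : ℕ → V)
    (edge : ℕ → EdgeType) : Prop where
  vert_zero : vert 0 = a
  vert_len : vert n = b
  hasEdge : ∀ k < n, G.HasEdge (edge k) (vert k) (vert (k + 1))
  isOpen : ∀ k ≤ n, G.Open C (vert k)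
    (0 < k ∧ k < n ∧ (edge (k - 1)).HeadAtEnd ∧ (edge k).HeadAtStart)

theorem ConnWalk.exists_isConnSeq {G : LMG V} {C : Set V} {a b : V} {p q : Prop}
    (h : G.ConnWalk C a p b q) (ha : a ∉ C) (hb : b ∉ C) :
    ∃ n vert edge, G.IsConnSeq C a b n vert edge := by
  suffices key : ∃ (n : ℕ) (vert : ℕ → V) (edge : ℕ → EdgeType), vert 0 = a ∧ vert (n + 1) = b ∧
      (∀ k ≤ n, G.HasEdge (edge k) (vert k) (vert (k + 1))) ∧ ((edge n).HeadAtEnd ↔ q) ∧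
      ∀ k < n, G.Open C (vert (k + 1)) ((edge k).HeadAtEnd ∧ (edge (k + 1)).HeadAtStart) by
    obtain ⟨n, vert, edge, h0, hn, he, -, ho⟩ := key
    refine ⟨n + 1, vert, edge, h0, hn, fun k hk => he k (by omega), fun k hk => ?_⟩
    rcases Nat.eq_zero_or_pos k with rfl | hk0
    · exact ⟨fun hc => (lt_irrefl _ hc.1).elim, fun _ => h0 ▸ ha⟩
    rcases hk.eq_or_lt with rfl | hkn
    · exact ⟨fun hc => (lt_irrefl _ hc.2.1).elim, fun _ => hn ▸ hb⟩
    obtain ⟨k, rfl⟩ : ∃ l, k = l + 1 := ⟨k - 1, by omega⟩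
    have h := ho k (by omega)
    exact ⟨fun hc => h.1 hc.2.2, fun hc => h.2 fun hc' => hc ⟨hk0, hkn, hc'⟩⟩
  clear hb
  induction h with
  | @single e a b he =>
    exact ⟨0, fun k => if k = 0 then a else b, fun _ => e, rfl, rfl,
      fun k hk => by obtain rfl : k = 0 := by omega
                     exact he, Iff.rfl, fun k hk => by omega⟩
  | @snoc a b c p q e hw he ho ih =>
    obtain ⟨n, vert, edge, h0, hn, hedge, hq, hopen⟩ := ih ha
    refine ⟨n + 1, fun k => if k ≤ n + 1 then vert k else c,
      fun k => if k ≤ n then edge k else e, by simpa using h0, by simp, ?_, by simp, ?_⟩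
    · intro k hk
      rcases hk.eq_or_lt with rfl | hk
      · simpa [hn] using he
      · have h := hedge k (by omega)
        simpa [show k ≤ n by omega, show k ≤ n + 1 by omega] using h
    · intro k hk
      by_cases hkn : k = n
      · subst hkn
        simpa [hn, hq] using ho
      · have h := hopen k (by omega)
        simpa [show k ≤ n by omega, show k + 1 ≤ n by omega] using h

/-- If `vert i = vert j` with `i < j`, where `i` and `j` are as far apart as possible, then the
walk can be shortened. -/
theorem IsColliderRegular.exists_shorter {G : LMG V} (hG : G.IsColliderRegular) {C : Set V}
    {a b : V} {n : ℕ} {vert : ℕ → V} {edge : ℕ → EdgeType} (h : G.IsConnSeq C a b n vert edge)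
    {i j : ℕ} (hij : i < j) (hjn : j ≤ n) (heq : vert i = vert j)
    (hmax : 0 < i → j < n → vert (i - 1) ≠ vert (j + 1)) :
    ∃ m < n, ∃ vert' edge', G.IsConnSeq C a b m vert' edge' := by
  obtain ⟨d, rfl⟩ : ∃ d, j = i + d := ⟨j - i, by omega⟩
  obtain ⟨m, rfl⟩ : ∃ m, n = m + d := ⟨n - d, by omega⟩
  refine ⟨m, by omega, fun k => if k ≤ i then vert k else vert (k + d),
    fun k => if k < i then edge k else edge (k + d), ?_, ?_, ?_, ?_⟩
  · simpa using h.vert_zero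
  · by_cases hm : m ≤ i
    · obtain rfl : m = i := by omega
      simpa [heq] using h.vert_len
    · simpa [hm] using h.vert_len
  · intro k hk
    rcases lt_trichotomy k i with hki | rfl | hki
    · simpa [hki, hki.le, Nat.succ_le_of_lt hki] using h.hasEdge k (by omega)
    · have h1 := h.hasEdge (k + d) (by omega)
      rw [← heq] at h1
      simpa [show k + 1 + d = k + d + 1 by omega] using h1
    · have h1 := h.hasEdge (k + d) (by omega)
      simpa [show ¬ k < i by omega, show ¬ k ≤ i by omega, show ¬ k + 1 ≤ i by omega,
        show k + 1 + d = k + d + 1 by omega] using h1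
  · intro k hk
    rcases lt_trichotomy k i with hki | rfl | hki
    · have h1 := h.isOpen k (by omega)
      simpa [hki, hki.le, show k - 1 < i by omega, show k < m by omega,
        show k < m + d by omega] using h1
    · by_cases hend : k = 0 ∨ k = m
      · have hC : vert k ∉ C := by
          rcases hend with rfl | rfl
          · exact (h.isOpen 0 (by omega)).2 fun hc => lt_irrefl _ hc.1
          · rw [heq]
            exact (h.isOpen (k + d) (by omega)).2 fun hc => lt_irrefl _ hc.2.1
        refine ⟨fun hc => ?_, fun _ => by simpa using hC⟩
        have h1 := hc.1
        have h2 := hc.2.1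
        omega
      have hk0 : 0 < k := by omega
      have hkm : k < m := by omega
      have hi := h.isOpen k (by omega)
      have hj := h.isOpen (k + d) (by omega)
      simp only [le_refl, if_true, lt_irrefl, if_false, show k - 1 < k by omega]
      constructor
      · rintro ⟨-, -, hin, hout⟩
        by_contra hbad
        have e1 := h.hasEdge (k - 1) (by omega)
        rw [show k - 1 + 1 = k by omega] at e1
        have e2 := h.hasEdge (k + d) (by omega)
        rw [← heq] at e2
        have hsel := hG.collider_not_selection _ _ _ (hmax hk0 (by omega))
          (e1.into_of_headAtEnd hin) (e2.into_of_headAtStart hout)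
        have desc : ∀ l < d, (vert (k + l) = vert k ∨ G.Ancestor (vert k) (vert (k + l))) ∧
            ¬ (edge (k + l)).HeadAtStart → G.Ancestor (vert k) (vert (k + l + 1)) := by
          rintro l hl ⟨h1, h2⟩
          have e3 := h.hasEdge (k + l) (by omega)
          have h3 : G.dir (vert (k + l)) (vert (k + l + 1)) := by
            generalize edge (k + l) = e at h2 e3
            cases e
            · exact (hsel _ h1 ⟨_, e3⟩).elim
            · exact e3
            · exact (h2 trivial).elim
            · exact (h2 trivial).elim
          rcases h1 with h1 | h1
          · rw [h1] at h3
            exact Relation.TransGen.single h3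
          · exact Relation.TransGen.tail h1 h3
        have key : ∀ l < d, (vert (k + l) = vert k ∨ G.Ancestor (vert k) (vert (k + l))) ∧
            ¬ (edge (k + l)).HeadAtStart := by
          intro l
          induction l with
          | zero =>
            intro _
            exact ⟨Or.inl rfl, fun hh => hbad (hi.1 ⟨hk0, by omega, hin, hh⟩)⟩
          | succ l ih =>
            intro hl
            have h1 := ih (by omega)
            have h2 := desc l (by omega) h1
            refine ⟨Or.inr h2, fun hh => hbad (Or.inr ?_)⟩
            have e3 := h.hasEdge (k + l) (by omega)
            have hhead : (edge (k + l)).HeadAtEnd := by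
              by_contra hno
              have hnh := h1.2
              generalize edge (k + l) = e at hno hnh e3
              cases e
              · exact hsel _ h1.1 ⟨_, e3⟩
              · exact hno trivial
              · exact hnh trivial
              · exact hnh trivial
            rcases (h.isOpen (k + l + 1) (by omega)).1
              ⟨by omega, by omega, hhead, hh⟩ with h4 | ⟨c, hc, h4⟩
            · exact ⟨_, h4, h2⟩
            · exact ⟨c, hc, Relation.TransGen.trans h2 h4⟩
        have hlast := desc (d - 1) (by omega) (key (d - 1) (by omega))
        rw [show k + (d - 1) + 1 = k + d by omega, ← heq] at hlast
        exact hG.no_directed_cycle _ hlast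
      · intro hc
        by_cases hin : (edge (k - 1)).HeadAtEnd
        · rw [heq]
          exact hj.2 fun hc' => hc ⟨hk0, hkm, hin, hc'.2.2.2⟩
        · exact hi.2 fun hc' => hin hc'.2.2.1
    · have h1 := h.isOpen (k + d) (by omega)
      simpa [show ¬ k ≤ i by omega, show ¬ k < i by omega, show ¬ k - 1 < i by omega,
        show k - 1 + d = k + d - 1 by omega, show 0 < k by omega,
        show 0 < k ∨ 0 < d by omega] using h1

theorem IsColliderRegular.exists_mConnecting {G : LMG V} (hG : G.IsColliderRegular) {C : Set V}
    {a b : V} (h : ∃ n vert edge, G.IsConnSeq C a b n vert edge) :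
    ∃ π : G.Path a b, π.MConnecting C := by
  classical
  obtain ⟨vert, edge, hw⟩ := Nat.find_spec h
  have hmin := fun m => Nat.find_min (m := m) h
  generalize Nat.find h = n at hw hmin
  suffices hnd : ∀ k ≤ n, ∀ l ≤ n, vert k = vert l → k = l from
    ⟨⟨n, vert, edge, hw.vert_zero, hw.vert_len, hw.hasEdge, hnd⟩, hw.isOpen⟩
  suffices hlt : ∀ s i j, i + (n - j) = s → i < j → j ≤ n → vert i ≠ vert j by
    intro k hk l hl hkl
    rcases lt_trichotomy k l with h1 | h1 | h1
    · exact (hlt _ k l rfl h1 hl hkl).elim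
    · exact h1
    · exact (hlt _ l k rfl h1 hk hkl.symm).elim
  intro s
  induction s using Nat.strong_induction_on with
  | _ s ih =>
    intro i j hs hij hjn heq
    obtain ⟨m, hm, hw'⟩ := hG.exists_shorter hw hij hjn heq fun hi hj =>
      ih _ (show i - 1 + (n - (j + 1)) < s by omega) _ _ rfl (by omega) (by omega)
    exact absurd hw' (hmin m hm)

/-! ### Markov equivalence and maximality of the closure -/

theorem independenceModel_antitone {G H : LMG V} (h : G.IsContainedIn H)
    (hanc : H.Ancestor = G.Ancestor) : H.independenceModel ⊆ G.independenceModel := by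
  rintro ⟨A, B, C⟩ ⟨h1, h2, h3, hs⟩
  refine ⟨h1, h2, h3, fun a ha b hb π hπ => hs a ha b hb (π.ofContained h) fun k hk => ?_⟩
  have := hπ k hk
  rw [← hanc] at this
  exact this

theorem IsColliderRegular.markovEquiv_bidClosure {G : LMG V} (hG : G.IsColliderRegular) :
    G.bidClosure.MarkovEquiv G := by
  refine (independenceModel_antitone G.isContainedIn_bidClosure rfl).antisymm ?_
  rintro ⟨A, B, C⟩ ⟨h1, h2, h3, hs⟩
  refine ⟨h1, h2, h3, fun a ha b hb π hπ => ?_⟩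
  have haC : a ∉ C := Set.disjoint_left.1 h2 ha
  have hbC : b ∉ C := Set.disjoint_left.1 h3 hb
  have hab : a ≠ b := fun h => Set.disjoint_left.1 h1 ha (h ▸ hb)
  have hlen : 0 < π.len := by
    rw [Nat.pos_iff_ne_zero]
    intro h0
    exact hab (π.vert_zero.symm.trans (h0 ▸ π.vert_len))
  obtain ⟨p, q, hw⟩ := ConnWalk.of_path π hπ hlen
  have hw' : G.ConnWalk C a p b q := by
    refine ConnWalk.of_edges (G := G) (H := G.bidClosure) rfl ?_ hw
    rintro (_ | _ | _ | _) i j h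
    · exact ConnWalk.single (e := .und) h
    · exact ConnWalk.single (e := .fwd) h
    · exact ConnWalk.single (e := .bwd) h
    · rcases h with h | ⟨hij, hadj, μ, hμ⟩
      · exact ConnWalk.single (e := .bid) h
      · have h2 := μ.two_le_len hij hadj
        exact ConnWalk.of_bidirected_inducing μ hμ (by omega) fun k hk =>
          hμ.edge_eq_bid hG.no_directed_cycle hG.bid_not_ancestor h2 hk
  obtain ⟨μ, hμ⟩ := hG.exists_mConnecting (hw'.exists_isConnSeq haC hbC)
  exact hs a ha b hb μ hμ

/-- The ancestors of `a` and `b` and the endpoints of undirected edges, without `a` and `b`. -/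
def separator (G : LMG V) (a b : V) : Set V :=
  {v | v ≠ a ∧ v ≠ b ∧ (G.Ancestor v a ∨ G.Ancestor v b ∨ G.SelectionAdjacent v)}

/-- A path between nonadjacent nodes that is connecting given `G.separator a b` is inducing. -/
theorem IsColliderRegular.isInducing_of_mConnecting {G : LMG V} (hG : G.IsColliderRegular)
    {a b : V} (π : G.Path a b) (hπ : π.MConnecting (G.separator a b)) :
    π.IsInducing := by
  have hne : ∀ k, 0 < k → k < π.len → π.vert k ≠ a ∧ π.vert k ≠ b := by
    intro k h0 hn
    constructor <;> intro h
    · have := π.nodup _ hn.le 0 (by omega) (h.trans π.vert_zero.symm)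
      omega
    · have := π.nodup _ hn.le _ le_rfl (h.trans π.vert_len.symm)
      omega
  have hcolsel : ∀ k, π.IsCollider k → ∀ d, d = π.vert k ∨ G.Ancestor (π.vert k) d →
      ¬ G.SelectionAdjacent d := by
    rintro k ⟨h0, hn, h1, h2⟩
    have e1 := π.hasEdge (k - 1) (by omega)
    rw [show k - 1 + 1 = k by omega] at e1
    refine hG.collider_not_selection _ _ _ (fun h => ?_) (e1.into_of_headAtEnd h1)
      ((π.hasEdge k hn).into_of_headAtStart h2)
    have := π.nodup _ (by omega) _ (by omega) h
    omega
  have hsel : ∀ k, 0 < k → k < π.len → ¬ G.SelectionAdjacent (π.vert k) := by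
    intro k h0 hn hs
    by_cases hc : π.IsCollider k
    · exact hcolsel k hc _ (Or.inl rfl) hs
    · exact (hπ k hn.le).2 hc ⟨(hne k h0 hn).1, (hne k h0 hn).2, Or.inr (Or.inr hs)⟩
  have hcol : ∀ k, π.IsCollider k → G.Ancestor (π.vert k) a ∨ G.Ancestor (π.vert k) b := by
    intro k hc
    rcases (hπ k hc.2.1.le).1 hc with ⟨-, -, h | h | h⟩ | ⟨c, ⟨-, -, h | h | h⟩, hkc⟩
    · exact Or.inl h
    · exact Or.inr h
    · exact (hcolsel k hc _ (Or.inl rfl) h).elim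
    · exact Or.inl (Relation.TransGen.trans hkc h)
    · exact Or.inr (Relation.TransGen.trans hkc h)
    · exact (hcolsel k hc _ (Or.inr hkc) h).elim
  have hfwd : ∀ s k, k + s + 1 = π.len → 0 < k → ¬ (π.edge k).HeadAtStart →
      G.Ancestor (π.vert k) a ∨ G.Ancestor (π.vert k) b := by
    intro s
    induction s with
    | zero =>
      intro k hk h0 hh
      have e1 := π.hasEdge k (by omega)
      rw [show k + 1 = π.len by omega, π.vert_len] at e1
      have hs := hsel k h0 (by omega)
      generalize π.edge k = e at hh e1
      cases e
      · exact (hs ⟨_, e1⟩).elim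
      · exact Or.inr (Relation.TransGen.single e1)
      · exact (hh trivial).elim
      · exact (hh trivial).elim
    | succ s ih =>
      intro k hk h0 hh
      have e1 := π.hasEdge k (by omega)
      have hs := hsel k h0 (by omega)
      have key : G.dir (π.vert k) (π.vert (k + 1)) ∧ (π.edge k).HeadAtEnd := by
        generalize π.edge k = e at hh e1
        cases e
        · exact (hs ⟨_, e1⟩).elim
        · exact ⟨e1, trivial⟩
        · exact (hh trivial).elim
        · exact (hh trivial).elim
      have hnext : G.Ancestor (π.vert (k + 1)) a ∨ G.Ancestor (π.vert (k + 1)) b := by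
        by_cases hh' : (π.edge (k + 1)).HeadAtStart
        · exact hcol _ ⟨by omega, by omega, key.2, hh'⟩
        · exact ih (k + 1) (by omega) (by omega) hh'
      exact hnext.imp (Relation.TransGen.head key.1) (Relation.TransGen.head key.1)
  have hbwd : ∀ k, k + 1 < π.len → ¬ (π.edge k).HeadAtEnd →
      G.Ancestor (π.vert (k + 1)) a ∨ G.Ancestor (π.vert (k + 1)) b := by
    intro k
    induction k with
    | zero =>
      intro hk hh
      have e1 := π.hasEdge 0 (by omega)
      rw [π.vert_zero] at e1
      have hs := hsel 1 (by omega) hk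
      generalize π.edge 0 = e at hh e1
      cases e
      · exact (hs ⟨_, G.und_symm _ _ e1⟩).elim
      · exact (hh trivial).elim
      · exact Or.inl (Relation.TransGen.single e1)
      · exact (hh trivial).elim
    | succ k ih =>
      intro hk hh
      have e1 := π.hasEdge (k + 1) (by omega)
      have hs := hsel (k + 1) (by omega) (by omega)
      have key : G.dir (π.vert (k + 1 + 1)) (π.vert (k + 1)) ∧ (π.edge (k + 1)).HeadAtStart := by
        generalize π.edge (k + 1) = e at hh e1
        cases e
        · exact (hs ⟨_, e1⟩).elim
        · exact (hh trivial).elim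
        · exact ⟨e1, trivial⟩
        · exact (hh trivial).elim
      have hnext : G.Ancestor (π.vert (k + 1)) a ∨ G.Ancestor (π.vert (k + 1)) b := by
        by_cases hh' : (π.edge k).HeadAtEnd
        · exact hcol _ ⟨by omega, by omega, hh', key.2⟩
        · exact ih (by omega) hh'
      exact hnext.imp (Relation.TransGen.head key.1) (Relation.TransGen.head key.1)
  intro k h0 hn
  by_cases hc : π.IsCollider k
  · exact ⟨hc, hcol k hc⟩
  · exfalso
    refine (hπ k hn.le).2 hc ⟨(hne k h0 hn).1, (hne k h0 hn).2, ?_⟩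
    have han : G.Ancestor (π.vert k) a ∨ G.Ancestor (π.vert k) b := by
      by_cases h1 : (π.edge k).HeadAtStart
      · have h2 := hbwd (k - 1) (by omega) fun h2 => hc ⟨h0, hn, h2, h1⟩
        rwa [show k - 1 + 1 = k by omega] at h2
      · exact hfwd (π.len - k - 1) k (by omega) h0 h1
    exact han.imp id Or.inl

/-- Nodes that are not adjacent in the closure are separated by `G.separator a b`. -/
theorem IsColliderRegular.separator_mem {G : LMG V} (hG : G.IsColliderRegular) {a b : V}
    (hab : a ≠ b) (hadj : ¬ G.bidClosure.Adj a b) :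
    ({a}, {b}, G.separator a b) ∈ G.independenceModel := by
  refine ⟨by simpa using hab, ?_, ?_, ?_⟩
  · exact Set.disjoint_singleton_left.2 fun h => h.1 rfl
  · exact Set.disjoint_singleton_left.2 fun h => h.2.1 rfl
  · rintro a' rfl b' rfl π hπ
    refine hadj ⟨.bid, Or.inr ⟨hab, fun ⟨e, he⟩ => hadj ⟨e, G.isContainedIn_bidClosure _ _ _ he⟩,
      π, hG.isInducing_of_mConnecting π hπ⟩⟩

theorem not_mem_independenceModel_of_hasEdge {G : LMG V} {e : EdgeType} {a b : V}
    (h : G.HasEdge e a b) (C : Set V) : ({a}, {b}, C) ∉ G.independenceModel := by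
  rintro ⟨-, h1, h2, hs⟩
  exact hs a rfl b rfl (Path.ofEdge h) (Path.ofEdge_mConnecting h
    (Set.disjoint_singleton_left.1 h1) (Set.disjoint_singleton_left.1 h2))

theorem hasEdge_addEdge (G : LMG V) (e : EdgeType) (a b : V) (hab : a ≠ b) :
    (G.addEdge e a b hab).HasEdge e a b := by
  cases e
  · exact Or.inr ⟨rfl, Or.inl ⟨rfl, rfl⟩⟩
  · exact Or.inr (Or.inl ⟨rfl, rfl, rfl⟩)
  · exact Or.inr (Or.inr ⟨rfl, rfl, rfl⟩)
  · exact Or.inr ⟨rfl, Or.inl ⟨rfl, rfl⟩⟩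

theorem IsColliderRegular.isMaximal_bidClosure {G : LMG V} (hG : G.IsColliderRegular) :
    G.bidClosure.IsMaximal := by
  intro e a b hab hadj heq
  refine not_mem_independenceModel_of_hasEdge (G.bidClosure.hasEdge_addEdge e a b hab)
    (G.separator a b) ?_
  rw [heq, hG.markovEquiv_bidClosure]
  exact hG.separator_mem hab hadj

/-! ### Uniqueness -/

theorem Path.EndpointIdentical.eq_bid {G : LMG V} {a b : V} {π : G.Path a b} {e : EdgeType}
    (h : π.EndpointIdentical e) (h0 : π.edge 0 = .bid) (hn : π.edge (π.len - 1) = .bid) :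
    e = .bid := by
  obtain ⟨-, h1, h2⟩ := h
  rw [h0] at h1
  rw [hn] at h2
  cases e
  · exact (h1.2 trivial).elim
  · exact (h1.2 trivial).elim
  · exact (h2.2 trivial).elim
  · rfl

/-- A graph between `G` and its closure that arises from `G` by adding bidirected edges is the
closure if it is maximal and Markov equivalent to `G`. -/
theorem IsColliderRegular.eq_bidClosure {G H : LMG V} (hG : G.IsColliderRegular)
    (hGH : G.IsContainedIn H) (hmax : H.IsMaximal) (hequiv : H.MarkovEquiv G)
    (hadd : ∀ e a b, H.HasEdge e a b → G.HasEdge e a b ∨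
      (e = .bid ∧ ¬ G.Adj a b ∧ G.bidClosure.bid a b)) : H = G.bidClosure := by
  have hund : H.und = G.und := by
    ext i j
    refine ⟨fun h => ?_, fun h => hGH .und i j h⟩
    rcases hadd .und i j h with h' | ⟨h', -⟩
    · exact h'
    · cases h'
  have hdir : H.dir = G.dir := by
    ext i j
    refine ⟨fun h => ?_, fun h => hGH .fwd i j h⟩
    rcases hadd .fwd i j h with h' | ⟨h', -⟩
    · exact h'
    · cases h'
  have hle : ∀ i j, H.bid i j → G.bidClosure.bid i j := by
    intro i j h
    rcases hadd .bid i j h with h' | ⟨-, -, h'⟩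
    · exact Or.inl h'
    · exact h'
  have hge : ∀ i j, G.bidClosure.bid i j → H.bid i j := by
    intro i j h
    by_contra hH
    rcases id h with h' | ⟨hij, hadj, -⟩
    · exact hH (hGH .bid i j h')
    have hHadj : ¬ H.Adj i j := by
      rintro ⟨e, he⟩
      rcases hadd e i j he with h' | ⟨rfl, -⟩
      · exact hadj ⟨e, h'⟩
      · exact hH he
    refine hmax .bid i j hij hHadj ?_
    have hdir' : (H.addEdge .bid i j hij).dir = G.dir := by
      rw [← hdir]
      ext k l
      simp [addEdge]
    have hund' : (H.addEdge .bid i j hij).und = G.und := by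
      rw [← hund]
      ext k l
      simp [addEdge]
    have hanc := ancestor_congr hdir'
    have hup : (H.addEdge .bid i j hij).IsContainedIn G.bidClosure := by
      rintro (_ | _ | _ | _) k l hkl
      · exact (congrFun₂ hund' k l).mp hkl
      · exact (congrFun₂ hdir' k l).mp hkl
      · exact (congrFun₂ hdir' l k).mp hkl
      · rcases hkl with hkl | ⟨-, ⟨rfl, rfl⟩ | ⟨rfl, rfl⟩⟩
        · exact hle _ _ hkl
        · exact h
        · exact G.bidClosure.bid_symm _ _ h
    have hlow : G.IsContainedIn (H.addEdge .bid i j hij) := by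
      rintro (_ | _ | _ | _) k l hkl
      · exact Or.inl (hGH .und _ _ hkl)
      · exact Or.inl (hGH .fwd _ _ hkl)
      · exact Or.inl (hGH .bwd _ _ hkl)
      · exact Or.inl (hGH .bid _ _ hkl)
    have h1 := independenceModel_antitone hlow hanc
    have h2 := independenceModel_antitone hup (G.ancestor_bidClosure.trans hanc.symm)
    rw [hG.markovEquiv_bidClosure] at h2
    exact (h1.antisymm h2).trans hequiv.symm
  refine LMG.ext hund hdir ?_
  ext i j
  exact ⟨hle i j, hge i j⟩

theorem IsColliderRegular.isMaximalRibbonlessExtension_iff {G : LMG V}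
    (hG : G.IsColliderRegular) (hrib : G.bidClosure.IsRibbonless) (H : LMG V) :
    G.IsMaximalRibbonlessExtension H ↔ H = G.bidClosure := by
  have hbid : ∀ {a b : V} (π : G.Path a b), π.IsInducing → 2 ≤ π.len →
      ∀ k < π.len, π.edge k = .bid := fun π hπ h2 k hk =>
    hπ.edge_eq_bid hG.no_directed_cycle hG.bid_not_ancestor h2 hk
  constructor
  · intro h
    refine hG.eq_bidClosure h.contains h.maximal h.markovEquiv fun e a b he => ?_
    by_cases heG : G.HasEdge e a b
    · exact Or.inl heG
    obtain ⟨hadj, π, hπ, hend⟩ := h.added e a b he heG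
    have h2 := π.two_le_len he.ne hadj
    exact Or.inr ⟨hend.eq_bid (hbid π hπ h2 _ (by omega)) (hbid π hπ h2 _ (by omega)), hadj,
      Or.inr ⟨he.ne, hadj, π, hπ⟩⟩
  · rintro rfl
    refine ⟨G.isContainedIn_bidClosure, hrib, hG.isMaximal_bidClosure,
      hG.markovEquiv_bidClosure, ?_⟩
    rintro (_ | _ | _ | _) a b h hn
    · exact (hn h).elim
    · exact (hn h).elim
    · exact (hn h).elim
    · rcases h with h | ⟨hab, hadj, π, hπ⟩
      · exact (hn h).elim
      · have h2 := π.two_le_len hab hadj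
        refine ⟨hadj, π, hπ, by omega, ?_, ?_⟩
        · rw [hbid π hπ h2 0 (by omega)]
        · rw [hbid π hπ h2 (π.len - 1) (by omega)]

/-- In an ancestral graph there is at most one edge between two nodes. -/
theorem IsAncestral.edge_unique {G : LMG V} (hG : G.IsAncestral) {i j : V} {e f : EdgeType}
    (he : G.HasEdge e i j) (hf : G.HasEdge f i j) : e = f := by
  have hanc : ∀ {k l : V}, G.dir k l → G.Ancestor k l := Relation.TransGen.single
  have hund : G.und i j → ¬ G.dir i j ∧ ¬ G.dir j i ∧ ¬ G.bid i j := fun h =>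
    ⟨(hG.und_no_arrowhead i j h i).2.2.1, (hG.und_no_arrowhead i j h j).1,
      (hG.und_no_arrowhead i j h i).2.2.2⟩
  have hdir : G.dir i j → ¬ G.dir j i := fun h h' =>
    hG.no_directed_cycle i (Relation.TransGen.trans (hanc h) (hanc h'))
  have hb : G.bid i j → ¬ G.dir i j ∧ ¬ G.dir j i := fun h =>
    ⟨fun h' => (hG.bid_not_ancestor i j h).1 (hanc h'),
      fun h' => (hG.bid_not_ancestor i j h).2 (hanc h')⟩
  cases e <;> cases f <;> simp only [HasEdge] at he hf <;> first | rfl | (exfalso; tauto)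

theorem IsAncestral.isMaximalAncestralExtension_iff {G : LMG V} (hG : G.IsAncestral)
    (H : LMG V) : G.IsMaximalAncestralExtension H ↔ H = G.bidClosure := by
  have hreg := hG.isColliderRegular
  constructor
  · intro h
    have hH := h.ancestral
    refine hreg.eq_bidClosure h.contains h.maximal h.markovEquiv fun e a b he => ?_
    by_cases hadj : G.Adj a b
    · obtain ⟨f, hf⟩ := hadj
      rw [hH.edge_unique he (h.contains _ _ _ hf)]
      exact Or.inl hf
    have hcl : G.bidClosure.Adj a b := by
      by_contra hcl
      have h1 := hreg.separator_mem he.ne hcl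
      rw [← h.markovEquiv] at h1
      exact not_mem_independenceModel_of_hasEdge he _ h1
    obtain ⟨-, π, hπ⟩ : a ≠ b ∧ ∃ π : G.Path a b, π.IsInducing := by
      obtain ⟨f, hf⟩ := hcl
      cases f
      · exact (hadj ⟨.und, hf⟩).elim
      · exact (hadj ⟨.fwd, hf⟩).elim
      · exact (hadj ⟨.bwd, hf⟩).elim
      · rcases hf with hf | ⟨hab, -, hπ⟩
        · exact (hadj ⟨.bid, hf⟩).elim
        · exact ⟨hab, hπ⟩
    refine Or.inr ⟨?_, hadj, Or.inr ⟨he.ne, hadj, π, hπ⟩⟩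
    have h2 := π.two_le_len he.ne hadj
    have hπH : (π.ofContained h.contains).IsInducing := fun k h0 hn =>
      ⟨(hπ k h0 hn).1, (hπ k h0 hn).2.imp (Ancestor.mono fun i j => h.contains .fwd i j)
        (Ancestor.mono fun i j => h.contains .fwd i j)⟩
    have hab := hπH.not_ancestor hH.no_directed_cycle hH.bid_not_ancestor h2
    have hba := hπH.reverse.not_ancestor hH.no_directed_cycle hH.bid_not_ancestor h2
    have hfirst := π.hasEdge 0 (by omega)
    rw [hπ.edge_eq_bid hG.no_directed_cycle hG.bid_not_ancestor h2 (by omega),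
      π.vert_zero] at hfirst
    cases e
    · exact (hH.not_into_of_und he _
        (Or.inr (H.bid_symm _ _ (h.contains .bid _ _ hfirst)))).elim
    · exact (hab (Relation.TransGen.single he)).elim
    · exact (hba (Relation.TransGen.single he)).elim
    · rfl
  · rintro rfl
    exact ⟨G.isContainedIn_bidClosure, hG.bidClosure, hreg.isMaximal_bidClosure,
      hreg.markovEquiv_bidClosure⟩

/-! ### Interventional graphs -/

section Interventional

variable {ι : Type*} {I : ι → Set V}

theorem interventional_hasEdge_inl {G : LMG V} {e : EdgeType} {i j : V} :
    (G.interventional I).HasEdge e (Sum.inl i) (Sum.inl j) ↔ G.HasEdge e i j := by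
  cases e <;> simp [HasEdge, interventional]

theorem interventional_ancestor_target {G : LMG V} {x y : V ⊕ {t : ι // (I t).Nonempty}}
    (h : (G.interventional I).Ancestor x y) : ∃ j, y = Sum.inl j := by
  obtain ⟨z, -, ⟨_, j, -, rfl, -⟩ | ⟨_, j, -, rfl, -⟩⟩ := Relation.TransGen.tail'_iff.1 h <;>
    exact ⟨j, rfl⟩

theorem interventional_ancestor_inl {G : LMG V} {i j : V} :
    (G.interventional I).Ancestor (Sum.inl i) (Sum.inl j) ↔ G.Ancestor i j := by
  constructor
  · intro h
    suffices key : ∀ y, (G.interventional I).Ancestor (Sum.inl i) y →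
        ∀ j, y = Sum.inl j → G.Ancestor i j from key _ h j rfl
    intro y hy
    induction hy with
    | single h' =>
      rintro j rfl
      exact Relation.TransGen.single (interventional_hasEdge_inl (e := .fwd).1 h')
    | tail h1 h2 ih =>
      rintro j rfl
      obtain ⟨k, rfl⟩ := interventional_ancestor_target h1
      exact (ih k rfl).tail (interventional_hasEdge_inl (e := .fwd).1 h2)
  · intro h
    exact Relation.TransGen.lift Sum.inl
      (fun _ _ h' => interventional_hasEdge_inl (e := .fwd).2 h') _ _ h

theorem interventional_selectionAdjacent {G : LMG V} {x : V ⊕ {t : ι // (I t).Nonempty}}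
    (h : (G.interventional I).SelectionAdjacent x) :
    ∃ i, x = Sum.inl i ∧ G.SelectionAdjacent i := by
  obtain ⟨_, i, j, rfl, -, h⟩ := h
  exact ⟨i, rfl, j, h⟩

theorem IsAncestral.isColliderRegular_interventional {G : LMG V} (hG : G.IsAncestral)
    (hI : ∀ i, G.SelectionAdjacent i → ¬ DoublyIntervenes I i) :
    (G.interventional I).IsColliderRegular where
  no_directed_cycle := by
    intro x hx
    obtain ⟨i, rfl⟩ := interventional_ancestor_target hx
    exact hG.no_directed_cycle i (interventional_ancestor_inl.1 hx)
  bid_not_ancestor := by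
    rintro _ _ ⟨i, j, rfl, rfl, h⟩
    rw [interventional_ancestor_inl, interventional_ancestor_inl]
    exact hG.bid_not_ancestor i j h
  collider_not_selection := by
    intro x y z hxz hx hz d hd hS
    obtain ⟨i, rfl, j, hij⟩ := interventional_selectionAdjacent hS
    have hinto : ∀ w, (G.interventional I).Into w (Sum.inl i) →
        ∃ t, w = Sum.inr t ∧ i ∈ I t.1 := by
      rintro (w | t) (h | h)
      · exact (hG.not_into_of_und hij w
          (Or.inl (interventional_hasEdge_inl (e := .fwd).1 h))).elim
      · exact (hG.not_into_of_und hij w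
          (Or.inr (interventional_hasEdge_inl (e := .bid).1 h))).elim
      · rcases h with ⟨_, _, h, -⟩ | ⟨s, k, hs, hk, h⟩
        · cases h
        · cases hs
          cases hk
          exact ⟨t, rfl, h⟩
      · obtain ⟨_, _, h, -⟩ := h
        cases h
    rcases hd with rfl | hd
    · obtain ⟨s, rfl, hs⟩ := hinto x hx
      obtain ⟨t, rfl, ht⟩ := hinto z hz
      refine hI i ⟨j, hij⟩ ⟨s.1, t.1, fun h => hxz ?_, hs, ht⟩
      rw [Subtype.ext h]
    · obtain ⟨w, hyw, hw⟩ := Relation.TransGen.tail'_iff.1 hd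
      obtain ⟨t, rfl, -⟩ := hinto w (Or.inl hw)
      rcases Relation.reflTransGen_iff_eq_or_transGen.1 hyw with h | h
      · subst h
        rcases hx with (⟨_, _, -, h, -⟩ | ⟨_, _, -, h, -⟩) | ⟨_, _, -, h, -⟩ <;> cases h
      · obtain ⟨k, hk⟩ := interventional_ancestor_target h
        cases hk

/-- A path in `G`, as a path in the interventional graph. -/
def Path.toInterventional {G : LMG V} (I : ι → Set V) {a b : V} (π : G.Path a b) :
    (G.interventional I).Path (Sum.inl a) (Sum.inl b) where
  len := π.len
  vert k := Sum.inl (π.vert k)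
  edge := π.edge
  vert_zero := by rw [π.vert_zero]
  vert_len := by rw [π.vert_len]
  hasEdge k hk := interventional_hasEdge_inl.2 (π.hasEdge k hk)
  nodup k hk l hl h := π.nodup k hk l hl (Sum.inl_injective h)

theorem exists_inducing_of_interventional {G : LMG V} {a b : V}
    (π : (G.interventional I).Path (Sum.inl a) (Sum.inl b)) (hπ : π.IsInducing)
    (hV : ∀ k ≤ π.len, ∃ i, π.vert k = Sum.inl i) : ∃ μ : G.Path a b, μ.IsInducing := by
  have hvert : ∀ k ≤ π.len, Sum.inl (Sum.elim id (fun _ => a) (π.vert k)) = π.vert k := by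
    intro k hk
    obtain ⟨i, hi⟩ := hV k hk
    rw [hi]
    rfl
  refine ⟨⟨π.len, fun k => Sum.elim id (fun _ => a) (π.vert k), π.edge, ?_, ?_, ?_, ?_⟩, ?_⟩
  · rw [π.vert_zero]
    rfl
  · rw [π.vert_len]
    rfl
  · intro k hk
    have h := π.hasEdge k hk
    rw [← hvert k hk.le, ← hvert (k + 1) hk] at h
    exact interventional_hasEdge_inl.1 h
  · intro k hk l hl h
    refine π.nodup k hk l hl ?_
    rw [← hvert k hk, ← hvert l hl, h]
  · intro k h0 hn
    change k < π.len at hn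
    obtain ⟨h1, h2⟩ := hπ k h0 hn
    rw [← hvert k hn.le, interventional_ancestor_inl, interventional_ancestor_inl] at h2
    exact ⟨h1, h2⟩

theorem IsAncestral.bidClosure_interventional {G : LMG V} (hG : G.IsAncestral)
    (hI : ∀ i, G.SelectionAdjacent i → ¬ DoublyIntervenes I i) :
    G.bidClosure.interventional I = (G.interventional I).bidClosure := by
  have hreg := hG.isColliderRegular_interventional hI
  refine LMG.ext rfl rfl ?_
  ext x y
  constructor
  · rintro ⟨i, j, rfl, rfl, h | ⟨hij, hadj, π, hπ⟩⟩
    · exact Or.inl ⟨i, j, rfl, rfl, h⟩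
    · refine Or.inr ⟨fun h => hij (Sum.inl_injective h),
        fun ⟨e, he⟩ => hadj ⟨e, interventional_hasEdge_inl.1 he⟩, π.toInterventional I, ?_⟩
      intro k h0 hn
      exact ⟨(hπ k h0 hn).1, (hπ k h0 hn).2.imp interventional_ancestor_inl.2
        interventional_ancestor_inl.2⟩
  · rintro (⟨i, j, rfl, rfl, h⟩ | ⟨hxy, hadj, π, hπ⟩)
    · exact ⟨i, j, rfl, rfl, Or.inl h⟩
    · have h2 := π.two_le_len hxy hadj
      have hbid : ∀ k < π.len, (G.interventional I).bid (π.vert k) (π.vert (k + 1)) := by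
        intro k hk
        have h := π.hasEdge k hk
        rwa [hπ.edge_eq_bid hreg.no_directed_cycle hreg.bid_not_ancestor h2 hk] at h
      have hV : ∀ k ≤ π.len, ∃ i, π.vert k = Sum.inl i := by
        intro k hk
        rcases hk.eq_or_lt with h | h
        · obtain ⟨_, j, -, hj, -⟩ := hbid (k - 1) (by omega)
          rw [show k - 1 + 1 = k by omega] at hj
          exact ⟨j, hj⟩
        · obtain ⟨i, _, hi, -⟩ := hbid k h
          exact ⟨i, hi⟩
      obtain ⟨i, hi⟩ := hV 0 (by omega)
      obtain ⟨j, hj⟩ := hV π.len le_rfl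
      rw [π.vert_zero] at hi
      rw [π.vert_len] at hj
      subst hi hj
      exact ⟨i, j, rfl, rfl, Or.inr ⟨fun h => hxy (h ▸ rfl),
        fun ⟨e, he⟩ => hadj ⟨e, interventional_hasEdge_inl.2 he⟩,
        exists_inducing_of_interventional π hπ hV⟩⟩

end Interventional

end LMG

/-- `Gbar` is the maximal extension of `G` (the only maximal ancestral one and the only maximal
ribbonless one), `GIbar` is the maximal extension of the interventional graph, and the
interventional graph of `Gbar` is `GIbar`. -/
theorem mainTheorem5 {V ι : Type*} [Finite V] [Finite ι] (G : LMG V) (hG : G.IsAncestral)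
    (I : ι → Set V) (hI : ∀ i, G.SelectionAdjacent i → ¬ LMG.DoublyIntervenes I i) :
    ∃ (Gbar : LMG V) (GIbar : LMG (V ⊕ {t : ι // (I t).Nonempty})),
      (∀ H, G.IsMaximalAncestralExtension H ↔ H = Gbar) ∧
      (∀ H, G.IsMaximalRibbonlessExtension H ↔ H = Gbar) ∧
      (∀ H, (G.interventional I).IsMaximalRibbonlessExtension H ↔ H = GIbar) ∧
      Gbar.interventional I = GIbar := by
  have hint := hG.bidClosure_interventional hI
  refine ⟨G.bidClosure, (G.interventional I).bidClosure, hG.isMaximalAncestralExtension_iff,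
    hG.isColliderRegular.isMaximalRibbonlessExtension_iff
      hG.bidClosure.isColliderRegular.isRibbonless,
    (hG.isColliderRegular_interventional hI).isMaximalRibbonlessExtension_iff ?_, hint⟩
  rw [← hint]
  exact (hG.bidClosure.isColliderRegular_interventional hI).isRibbonless
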